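/- **Colored insertion trees.** Let $D$ be a set (of "basic decorations": primitive graphs together with their insertion data). Consider finite rooted trees, not embedded in the plane, whose edges are colored black or red and whose vertices are decorated either by an element of $D$ or by an element of the algebra $\mathcal H_c$ itself. Here $\mathcal H_c$ is the commutative $\mathbb Q$-algebra spanned by forests of such trees, with disjoint union as product and the empty forest $\mathbb I$ as unit, modulo the conventions that, for a fixed root decoration, fixed other children and a fixed edge color, attaching a forest to the root is a linear operation on $\mathcal H_c$, that a tree depends only, and linearly, on those elements of $\mathcal H_c$ which decorate its vertices, that the decoration $d\in D$ is the same as the decoration by the one-vertex tree $\bullet_d$, and that for primitive $\gamma\in\mathcal H_c$ the one-vertex tree decorated by $\gamma$ is $\gamma$. The coproduct is the algebra homomorphism $\Delta:\mathcal H_c\to\mathcal H_c\otimes\mathcal H_c$ with $$\Delta(T)=T\otimes\mathbb I+\sum_c P_c(T)\otimes R_c(T),$$ where $c$ runs over the sets of edges that meet every path from the root to a leaf at most once, $R_c(T)$ is the component of the root after cutting $c$ and $P_c(T)$ is the forest of the other components; uncut edges keep their colors. An element $\gamma$ is primitive if $\Delta(\gamma)=\gamma\otimes\mathbb I+\mathbb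 I\otimes\gamma$. For $\gamma\in\mathcal H_c$ let $R_+^\gamma:\mathcal H_c\to\mathcal H_c$ be the linear map that joins the trees of a forest by red edges to a new root decorated by $\gamma$; in particular $R_+^\gamma(\mathbb I)=\gamma$ for primitive $\gamma$. **The Dyson–Schwinger system.** Let $\mathcal H\subseteq\mathcal H_c$ be a subalgebra with $\Delta(\mathcal H)\subseteq\mathcal H\otimes\mathcal H$, contained in the subalgebra generated by the trees with all decorations in $D$ and all edges black (the Hopf algebra of Feynman graphs, viewed inside $\mathcal H_c$ through black insertion trees). Let $\mathcal R$ be a finite set, and for $r\in\mathcal R$ and $k\ge1$ let $B_+^{k,i;r}$, $0\le i\le t^r_k$, be linear maps which preserve $\mathcal H$ (the insertion operators) and for which $\sum_{i=0}^{t^r_k}B_+^{k,i;r}$ is a Hochschild 1-cocycle on $\mathcal H$, that is, $L=\sum_iB_+^{k,i;r}$ satisfies $\Delta L=(\mathrm{id}\otimes L)\Delta+L\otimes\mathbb I$ on $\mathcal H$. Let $s_r\in\mathbb Z$ for $r\in\mathcal R$, put $\mathrm{sign}(s)=1$ for $s\ge0$ and $\mathrm{sign}(s)=-1$ for $s<0$,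 and let $X^r\in\mathcal H_c[[x]]$, $r\in\mathcal R$, be the solution of $$X^r=\mathbb I-\mathrm{sign}(s_r)\sum_{k\ge1}\sum_{i=0}^{t^r_k}x^kB_+^{k,i;r}(X^rQ^k),\qquad Q=\prod_{r\in\mathcal R}(X^r)^{-s_r}.$$ Writing $[x^n]$ for the coefficient of $x^n$, define recursively for $n\ge1$ $$q^r_n=-\mathrm{sign}(s_r)[x^n]X^r-\sum_{k=1}^{n-1}R_+^{q^r_k}\big([x^{n-k}]X^rQ^k\big).$$ **Theorem.** For all $r\in\mathcal R$ and $n\ge1$ the element $q^r_n$ is primitive in $\mathcal H_c$, and the same series $X^r$ satisfy the Dyson–Schwinger equations with only red (symmetric) insertions $$X^r=\mathbb I-\mathrm{sign}(s_r)\sum_{k\ge1}x^kR_+^{q^r_k}(X^rQ^k),\qquad r\in\mathcal R.$$ -/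

import Mathlib

open scoped TensorProduct

namespace InsertionTree

universe u v

/-- The two colours of an edge: `black` for ordinary insertion, `red` for symmetric insertion. -/
inductive Color : Type
  | black
  | red

/-- Finite rooted trees with decorated vertices and coloured edges (the edge joining a child to its
parent carries the colour listed with the child). A vertex is decorated either by a basic decoration
`d : D` (a primitive graph with its insertion data), or by a formal `ℚ`-linear combination of
forests of such trees: this is how an element of the algebra of coloured trees is itself used as a
decoration. The order of children (and all other redundancy) is divided out in `Hc`. -/
inductive CTree (D : Type u) : Type u
  | node (label : D ⊕ List (ℚ × List (CTree D))) (children : List (Color × CTree D)) : CTree D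

variable {D : Type u}

/-- Decorations of vertices. -/
abbrev Label (D : Type u) : Type u := D ⊕ List (ℚ × List (CTree D))

mutual

/-- All choices of a set of edges of a tree that meets every path from the root to a leaf at most
once. For each choice: the list of components cut off, and the component of the root. -/
def cuts : CTree D → List (List (CTree D) × CTree D)
  | .node l cs => (cutsBelow cs).map fun e => (e.1, .node l e.2)
termination_by T => sizeOf T

/-- The same choices for a root with the given children: each edge from the root is either cut, or
kept together with a choice of cut edges in the child. -/
def cutsBelow : List (Color × CTree D) → List (List (CTree D) × List (Color × CTree D))
  | [] => [([], [])]
  | (c, T) :: cs =>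
      (cutsBelow cs).flatMap fun p =>
        (T :: p.1, p.2) :: (cuts T).map fun e => (e.1 ++ p.1, (c, e.2) :: p.2)
termination_by cs => sizeOf cs

end

/-- Polynomials over `ℚ` in coloured trees: the span of forests, with disjoint union as product. -/
abbrev Pre (D : Type u) : Type u := MvPolynomial (CTree D) ℚ

/-- A forest as a monomial. -/
noncomputable def forest (F : List (CTree D)) : Pre D := (F.map MvPolynomial.X).prod

/-- The polynomial denoted by a formal linear combination of forests. -/
noncomputable def expr (p : List (ℚ × List (CTree D))) : Pre D :=
  (p.map fun t => t.1 • forest t.2).sum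

/-- The coproduct: multiplicative, and on a tree the sum over admissible cuts of (what is cut off)
`⊗` (the part containing the root), including the cut that removes the whole tree. The colours of
cut edges are forgotten, all other edges keep theirs. -/
noncomputable def preComul : Pre D →ₐ[ℚ] Pre D ⊗[ℚ] Pre D :=
  MvPolynomial.aeval fun T =>
    MvPolynomial.X T ⊗ₜ[ℚ] 1 + ((cuts T).map fun e => forest e.1 ⊗ₜ[ℚ] MvPolynomial.X e.2).sum

/-- The linear map that turns a forest into a tree, by attaching its trees with edges of colour `c`
to a root that is decorated by `l` and already has the children `cs`. -/
noncomputable def graft (l : Label D) (cs : List (Color × CTree D)) (c : Color) :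
    Pre D →ₗ[ℚ] Pre D :=
  (MvPolynomial.basisMonomials (CTree D) ℚ).constr ℚ fun m =>
    MvPolynomial.X (.node l (cs ++ (Finsupp.toMultiset m).toList.map fun T => (c, T)))

/-- `p ⊗ q ↦ [p] ⊗ [q]` modulo an ideal. -/
noncomputable abbrev tensorMk (J : Ideal (Pre D)) :
    Pre D ⊗[ℚ] Pre D →ₐ[ℚ] (Pre D ⧸ J) ⊗[ℚ] (Pre D ⧸ J) :=
  Algebra.TensorProduct.map (Ideal.Quotient.mkₐ ℚ J) (Ideal.Quotient.mkₐ ℚ J)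

/-- The identifications between coloured trees:
* trees are not embedded in the plane;
* grafting is well defined and linear in the grafted forest;
* a vertex decorated by an element of the algebra depends only, and linearly, on that element;
* being decorated by the basic decoration `d` is the same as being decorated by the element
  `•_d` (the one-vertex tree with decoration `d`);
* if `γ` is primitive, the one-vertex tree decorated by `γ` is `γ` itself. -/
structure IsCompatible (J : Ideal (Pre D)) : Prop where
  perm : ∀ (l : Label D) (cs cs' : List (Color × CTree D)), cs.Perm cs' →
    (MvPolynomial.X (.node l cs) - MvPolynomial.X (.node l cs') : Pre D) ∈ J
  graft_mem : ∀ (l : Label D) (cs : List (Color × CTree D)) (c : Color) (f : Pre D),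
    f ∈ J → graft l cs c f ∈ J
  label_linear : ∀ (L : List (ℚ × List (ℚ × List (CTree D)))) (cs : List (Color × CTree D)),
    (L.map fun a => a.1 • expr a.2).sum ∈ J →
      (L.map fun a => a.1 • (MvPolynomial.X (.node (.inr a.2) cs) : Pre D)).sum ∈ J
  label_basic : ∀ (d : D) (cs : List (Color × CTree D)),
    (MvPolynomial.X (.node (.inr [(1, [.node (.inl d) []])]) cs)
      - MvPolynomial.X (.node (.inl d) cs) : Pre D) ∈ J
  label_primitive : ∀ p : List (ℚ × List (CTree D)),
    tensorMk J (preComul (expr p)) =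
      Ideal.Quotient.mkₐ ℚ J (expr p) ⊗ₜ[ℚ] 1 + 1 ⊗ₜ[ℚ] Ideal.Quotient.mkₐ ℚ J (expr p) →
      MvPolynomial.X (.node (.inr p) []) - expr p ∈ J

/-- The smallest ideal that makes these identifications. -/
noncomputable def relations (D : Type u) : Ideal (Pre D) := sInf {J | IsCompatible J}

/-- The Hopf algebra of coloured insertion trees with basic decorations in `D`. -/
def Hc (D : Type u) : Type u := Pre D ⧸ relations D

noncomputable instance : CommRing (Hc D) := inferInstanceAs (CommRing (Pre D ⧸ relations D))

noncomputable instance : Algebra ℚ (Hc D) := inferInstanceAs (Algebra ℚ (Pre D ⧸ relations D))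

/-- The class of a polynomial in coloured trees in the Hopf algebra of coloured trees. -/
noncomputable def toHc : Pre D →ₐ[ℚ] Hc D := Ideal.Quotient.mkₐ ℚ (relations D)

theorem relations_le {J : Ideal (Pre D)} (hJ : IsCompatible J) : relations D ≤ J := sInf_le hJ

theorem tensorMk_of_le {I J : Ideal (Pre D)} (h : I ≤ J) (z : Pre D ⊗[ℚ] Pre D) :
    tensorMk J z = Algebra.TensorProduct.map (Ideal.Quotient.factorₐ ℚ h)
      (Ideal.Quotient.factorₐ ℚ h) (tensorMk I z) := by
  have : tensorMk J = (Algebra.TensorProduct.map (Ideal.Quotient.factorₐ ℚ h)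
      (Ideal.Quotient.factorₐ ℚ h)).comp (tensorMk I) := by
    ext <;> simp
  rw [this]; rfl

theorem primitive_of_le {I J : Ideal (Pre D)} (h : I ≤ J) {f : Pre D}
    (hf : tensorMk I (preComul f) =
      Ideal.Quotient.mkₐ ℚ I f ⊗ₜ[ℚ] 1 + 1 ⊗ₜ[ℚ] Ideal.Quotient.mkₐ ℚ I f) :
    tensorMk J (preComul f) =
      Ideal.Quotient.mkₐ ℚ J f ⊗ₜ[ℚ] 1 + 1 ⊗ₜ[ℚ] Ideal.Quotient.mkₐ ℚ J f := by
  rw [tensorMk_of_le h, hf]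
  simp

theorem relations_compatible : IsCompatible (relations D) where
  perm l cs cs' h := by
    refine (Submodule.mem_sInf).2 fun J hJ => hJ.perm l cs cs' h
  graft_mem l cs c f hf :=
    (Submodule.mem_sInf).2 fun J hJ => hJ.graft_mem l cs c f (relations_le hJ hf)
  label_linear L cs h :=
    (Submodule.mem_sInf).2 fun J hJ => hJ.label_linear L cs (relations_le hJ h)
  label_basic d cs := (Submodule.mem_sInf).2 fun J hJ => hJ.label_basic d cs
  label_primitive p h :=
    (Submodule.mem_sInf).2 fun J hJ => hJ.label_primitive p (primitive_of_le (relations_le hJ) h)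

theorem toHc_eq_zero {f : Pre D} : toHc f = 0 ↔ f ∈ relations D := Ideal.Quotient.eq_zero_iff_mem

theorem toHc_surjective : Function.Surjective (toHc : Pre D → Hc D) :=
  Ideal.Quotient.mk_surjective

/-- The coproduct with values in the tensor square of the quotient. -/
noncomputable def comulAux : Pre D →ₐ[ℚ] Hc D ⊗[ℚ] Hc D :=
  (Algebra.TensorProduct.map toHc toHc).comp preComul

theorem comulAux_eq (f : Pre D) : comulAux f = tensorMk (relations D) (preComul f) := rfl

theorem comulAux_X (T : CTree D) : comulAux (MvPolynomial.X T) =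
    toHc (MvPolynomial.X T) ⊗ₜ[ℚ] 1 +
      ((cuts T).map fun e => toHc (forest e.1) ⊗ₜ[ℚ] toHc (MvPolynomial.X e.2)).sum := by
  simp [comulAux, preComul, map_list_sum, Function.comp_def]

theorem toHc_node_perm (l : Label D) {cs cs' : List (Color × CTree D)} (h : cs.Perm cs') :
    toHc (MvPolynomial.X (.node l cs) : Pre D) = toHc (MvPolynomial.X (.node l cs')) :=
  sub_eq_zero.1 <| by
    rw [← map_sub]
    exact toHc_eq_zero.2 (relations_compatible.perm l cs cs' h)

theorem forest_eq_basis (F : List (CTree D)) : (forest F : Pre D) =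
    MvPolynomial.basisMonomials (CTree D) ℚ (F.map fun T => Finsupp.single T 1).sum := by
  induction F with
  | nil => simp [forest]
  | cons T F ih =>
    simp only [MvPolynomial.coe_basisMonomials] at ih ⊢
    rw [List.map_cons, List.sum_cons, ← one_mul (1 : ℚ), ← MvPolynomial.monomial_mul, ← ih]
    simp [forest, MvPolynomial.X]

theorem toMultiset_forest (F : List (CTree D)) :
    Finsupp.toMultiset (F.map fun T => Finsupp.single T 1).sum = (F : Multiset (CTree D)) := by
  induction F with
  | nil => simp
  | cons T F ih => simp [ih]

theorem graft_forest (l : Label D) (cs : List (Color × CTree D)) (c : Color) (F : List (CTree D)) :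
    toHc (graft l cs c (forest F)) =
      toHc (MvPolynomial.X (.node l (cs ++ F.map fun T => (c, T)))) := by
  rw [forest_eq_basis, graft, Module.Basis.constr_basis]
  apply toHc_node_perm
  apply List.Perm.append_left
  apply List.Perm.map
  rw [← Multiset.coe_eq_coe]
  simp [toMultiset_forest]

/-- Every element is denoted by a formal linear combination of forests. -/
theorem exists_expr (f : Pre D) : ∃ p, expr p = f := by
  classical
  induction f using MvPolynomial.induction_on' with
  | monomial u a =>
    refine ⟨[(a, (Finsupp.toMultiset u).toList)], ?_⟩
    have h : ((Finsupp.toMultiset u).toList.map fun T => Finsupp.single T 1).sum = u := by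
      apply Multiset.toFinsupp.symm.injective
      change Finsupp.toMultiset _ = Finsupp.toMultiset _
      rw [toMultiset_forest]
      simp
    simp [expr, forest_eq_basis, MvPolynomial.smul_monomial, h]
  | add f g hf hg =>
    obtain ⟨p, rfl⟩ := hf
    obtain ⟨p', rfl⟩ := hg
    exact ⟨p ++ p', by simp [expr]⟩

theorem forest_ext {M : Type*} [AddCommGroup M] [Module ℚ M] {φ ψ : Pre D →ₗ[ℚ] M}
    (h : ∀ F, φ (forest F) = ψ (forest F)) : φ = ψ := by
  refine LinearMap.ext fun f => ?_
  obtain ⟨p, rfl⟩ := exists_expr f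
  induction p with
  | nil => simp [expr]
  | cons t p ih =>
    simp only [expr, List.map_cons, List.sum_cons, map_add, map_smul, h] at ih ⊢
    rw [ih]

/-- The grafting operators on the quotient. -/
noncomputable def graftHc (l : Label D) (cs : List (Color × CTree D)) (c : Color) :
    Hc D →ₗ[ℚ] Hc D :=
  Submodule.mapQ ((relations D).restrictScalars ℚ) ((relations D).restrictScalars ℚ)
    (graft l cs c) fun f hf => relations_compatible.graft_mem l cs c f hf

theorem graftHc_toHc (l : Label D) (cs : List (Color × CTree D)) (c : Color) (f : Pre D) :
    graftHc l cs c (toHc f) = toHc (graft l cs c f) := rfl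

theorem graftHc_forest_cons (l : Label D) (cs : List (Color × CTree D)) (c : Color) (T : CTree D)
    (f : Hc D) : graftHc l cs c (toHc (MvPolynomial.X T) * f) =
      graftHc l (cs ++ [(c, T)]) c f := by
  obtain ⟨f, rfl⟩ := toHc_surjective f
  rw [← map_mul]
  have : toHc.toLinearMap ∘ₗ graft l cs c ∘ₗ LinearMap.mulLeft ℚ (MvPolynomial.X T : Pre D) =
      toHc.toLinearMap ∘ₗ graft l (cs ++ [(c, T)]) c := by
    apply forest_ext
    intro F
    have e : (MvPolynomial.X T * forest F : Pre D) = forest (T :: F) := by simp [forest]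
    simp only [LinearMap.comp_apply, LinearMap.mulLeft_apply, e, AlgHom.toLinearMap_apply,
      graft_forest]
    simp
  exact congrArg (fun φ => φ f) this

/-- Cuts below a root decorated by `l` that also has the uncut children `R`. -/
noncomputable def cutSum (l : Label D) (R cs : List (Color × CTree D)) : Hc D ⊗[ℚ] Hc D :=
  ((cutsBelow cs).map fun e =>
    toHc (forest e.1) ⊗ₜ[ℚ] toHc (MvPolynomial.X (.node l (R ++ e.2)))).sum

theorem forest_append (F G : List (CTree D)) : (forest (F ++ G) : Pre D) = forest F * forest G := by
  simp [forest]

theorem forest_cons (T : CTree D) (F : List (CTree D)) :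
    (forest (T :: F) : Pre D) = MvPolynomial.X T * forest F := by
  simp [forest]

theorem sum_map_add' {ι M : Type*} [AddCommMonoid M] (L : List ι) (f g : ι → M) :
    (L.map fun i => f i + g i).sum = (L.map f).sum + (L.map g).sum := by
  induction L with
  | nil => simp
  | cons a L ih => simp [ih, add_add_add_comm]

theorem sum_map_mul {ι M : Type*} [NonUnitalNonAssocSemiring M] (L : List ι) (a : M) (f : ι → M) :
    (L.map fun i => a * f i).sum = a * (L.map f).sum := by
  induction L with
  | nil => simp
  | cons b L ih => simp [ih, mul_add]

theorem sum_comm' {ι κ M : Type*} [AddCommMonoid M] (L : List ι) (K : List κ) (f : ι → κ → M) :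
    (L.map fun i => (K.map fun k => f i k).sum).sum =
      (K.map fun k => (L.map fun i => f i k).sum).sum := by
  induction L with
  | nil => simp
  | cons a L ih => simp [ih]

theorem sum_flatMap' {ι M : Type*} [AddCommMonoid M] (L : List ι) (f : ι → List M) :
    (L.flatMap f).sum = (L.map fun i => (f i).sum).sum := by
  induction L with
  | nil => simp
  | cons a L ih => simp [ih]

theorem cutSum_cons (l : Label D) (R : List (Color × CTree D)) (c : Color) (T : CTree D)
    (cs : List (Color × CTree D)) :
    cutSum l R ((c, T) :: cs) = (toHc (MvPolynomial.X T) ⊗ₜ[ℚ] 1) * cutSum l R cs +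
      ((cuts T).map fun e => (toHc (forest e.1) ⊗ₜ[ℚ] 1) * cutSum l (R ++ [(c, e.2)]) cs).sum := by
  simp only [cutSum, cutsBelow]
  simp only [← sum_map_mul]
  rw [sum_comm', ← sum_map_add', List.map_flatMap, sum_flatMap']
  congr 1
  refine List.map_congr_left fun p _ => ?_
  simp [forest_append, forest_cons, Function.comp_def]

theorem cutSum_perm (l : Label D) {cs cs' : List (Color × CTree D)} (h : cs.Perm cs') :
    ∀ {R R' : List (Color × CTree D)}, R.Perm R' → cutSum l R cs = cutSum l R' cs' := by
  induction h with
  | nil =>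
    intro R R' h
    simp only [cutSum, cutsBelow, List.map_cons, List.map_nil, List.append_nil, toHc_node_perm l h]
  | cons x _ ih =>
    intro R R' h
    obtain ⟨c, T⟩ := x
    rw [cutSum_cons, cutSum_cons, ih h]
    congr 2
    refine List.map_congr_left fun e _ => ?_
    rw [ih (h.append_right _)]
  | swap x y cs =>
    intro R R' h
    obtain ⟨c, T⟩ := x
    obtain ⟨c', T'⟩ := y
    have key : ∀ {R R' : List (Color × CTree D)}, R.Perm R' → cutSum l R cs = cutSum l R' cs := by
      intro R R' h
      simp only [cutSum]
      congr 1
      refine List.map_congr_left fun e _ => ?_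
      rw [toHc_node_perm l (h.append_right _)]
    simp only [cutSum_cons, mul_add, sum_map_add']
    simp only [← sum_map_mul]
    have a1 := congrArg (fun z => (toHc (MvPolynomial.X T') ⊗ₜ[ℚ] (1 : Hc D)) *
      ((toHc (MvPolynomial.X T) ⊗ₜ[ℚ] 1) * z)) (key h)
    have a2 : ∀ (U : CTree D) (L : List (List (CTree D) × CTree D)) (c : Color),
        (L.map fun e => (toHc (MvPolynomial.X U) ⊗ₜ[ℚ] (1 : Hc D)) *
          ((toHc (forest e.1) ⊗ₜ[ℚ] 1) * cutSum l (R ++ [(c, e.2)]) cs)).sum =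
        (L.map fun e => (toHc (forest e.1) ⊗ₜ[ℚ] (1 : Hc D)) *
          ((toHc (MvPolynomial.X U) ⊗ₜ[ℚ] 1) * cutSum l (R' ++ [(c, e.2)]) cs)).sum := by
      intro U L c
      congr 1
      refine List.map_congr_left fun e _ => ?_
      rw [key (h.append_right _), mul_left_comm]
    have a3 : ∀ (U : CTree D) (L : List (List (CTree D) × CTree D)) (c : Color),
        (L.map fun e => (toHc (forest e.1) ⊗ₜ[ℚ] (1 : Hc D)) *
          ((toHc (MvPolynomial.X U) ⊗ₜ[ℚ] 1) * cutSum l (R ++ [(c, e.2)]) cs)).sum =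
        (L.map fun e => (toHc (MvPolynomial.X U) ⊗ₜ[ℚ] (1 : Hc D)) *
          ((toHc (forest e.1) ⊗ₜ[ℚ] 1) * cutSum l (R' ++ [(c, e.2)]) cs)).sum := by
      intro U L c
      congr 1
      refine List.map_congr_left fun e _ => ?_
      rw [key (h.append_right _), mul_left_comm]
    have a4 : ((cuts T').map fun e' => ((cuts T).map fun e =>
          (toHc (forest e'.1) ⊗ₜ[ℚ] (1 : Hc D)) * ((toHc (forest e.1) ⊗ₜ[ℚ] 1) *
            cutSum l (R ++ [(c', e'.2)] ++ [(c, e.2)]) cs)).sum).sum =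
        ((cuts T).map fun e => ((cuts T').map fun e' =>
          (toHc (forest e.1) ⊗ₜ[ℚ] (1 : Hc D)) * ((toHc (forest e'.1) ⊗ₜ[ℚ] 1) *
            cutSum l (R' ++ [(c, e.2)] ++ [(c', e'.2)]) cs)).sum).sum := by
      rw [sum_comm']
      congr 1
      refine List.map_congr_left fun e _ => ?_
      congr 1
      refine List.map_congr_left fun e' _ => ?_
      rw [mul_left_comm, key]
      rw [List.append_assoc, List.append_assoc]
      exact h.append (List.Perm.swap _ _ _)
    linear_combination a1 + a2 T' (cuts T) c + a3 T (cuts T') c' + a4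
  | trans _ _ ih ih' =>
    intro R R' h
    rw [ih h, ih' (List.Perm.refl _)]

theorem cutSum_append (l : Label D) (ds : List (Color × CTree D)) :
    ∀ (cs R : List (Color × CTree D)), cutSum l R (cs ++ ds) =
      ((cutsBelow cs).map fun e => (toHc (forest e.1) ⊗ₜ[ℚ] 1) * cutSum l (R ++ e.2) ds).sum
  | [], R => by simp [cutsBelow, forest, ← Algebra.TensorProduct.one_def]
  | (c, T) :: cs, R => by
    rw [List.cons_append, cutSum_cons, cutSum_append l ds cs R]
    simp only [cutSum_append l ds cs, cutsBelow]
    simp only [← sum_map_mul]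
    rw [sum_comm', ← sum_map_add', List.map_flatMap, sum_flatMap']
    congr 1
    refine List.map_congr_left fun p _ => ?_
    simp [forest_append, forest_cons, Function.comp_def, ← mul_assoc]

theorem comulAux_node (l : Label D) (cs : List (Color × CTree D)) :
    comulAux (MvPolynomial.X (.node l cs)) =
      toHc (MvPolynomial.X (.node l cs)) ⊗ₜ[ℚ] 1 + cutSum l [] cs := by
  simp [comulAux_X, cutSum, cuts, Function.comp_def]

theorem cutSum_forest (l : Label D) (c : Color) :
    ∀ (F : List (CTree D)) (R : List (Color × CTree D)), cutSum l R (F.map fun T => (c, T)) =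
      TensorProduct.map LinearMap.id (graftHc l R c) (comulAux (forest F))
  | [], R => by
    have := graft_forest l R c []
    simp only [forest, List.map_nil, List.prod_nil, List.append_nil] at this
    simp [cutSum, cutsBelow, forest, Algebra.TensorProduct.one_def, ← this, ← graftHc_toHc]
  | T :: F, R => by
    have key : ∀ (T' : CTree D) (P : Hc D) (R : List (Color × CTree D)) (z : Hc D ⊗[ℚ] Hc D),
        TensorProduct.map LinearMap.id (graftHc l R c)
          ((P ⊗ₜ[ℚ] toHc (MvPolynomial.X T')) * z) =
        (P ⊗ₜ[ℚ] 1) * TensorProduct.map LinearMap.id (graftHc l (R ++ [(c, T')]) c) z := by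
      intro T' P R z
      induction z with
      | zero => simp
      | add a b ha hb => simp [mul_add, ha, hb]
      | tmul a b => simp [graftHc_forest_cons]
    have key' : ∀ (P : Hc D) (z : Hc D ⊗[ℚ] Hc D),
        TensorProduct.map LinearMap.id (graftHc l R c) ((P ⊗ₜ[ℚ] 1) * z) =
        (P ⊗ₜ[ℚ] 1) * TensorProduct.map LinearMap.id (graftHc l R c) z := by
      intro P z
      induction z with
      | zero => simp
      | add a b ha hb => simp [mul_add, ha, hb]
      | tmul a b => simp
    rw [List.map_cons, cutSum_cons, forest_cons, map_mul, comulAux_X, add_mul, map_add, key',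
      cutSum_forest l c F R, mul_comm (List.sum _), ← sum_map_mul, map_list_sum, List.map_map]
    congr 2
    refine List.map_congr_left fun e _ => ?_
    rw [cutSum_forest l c F, Function.comp_apply, ← key, mul_comm]

/-- The coproduct of a grafting. -/
theorem comulAux_graft (l : Label D) (cs : List (Color × CTree D)) (c : Color) (f : Pre D) :
    comulAux (graft l cs c f) =
      toHc (graft l cs c f) ⊗ₜ[ℚ] 1 +
        ((cutsBelow cs).map fun e => (toHc (forest e.1) ⊗ₜ[ℚ] 1) *
          TensorProduct.map LinearMap.id (graftHc l e.2 c) (comulAux f)).sum := by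
  have hF : ∀ F : List (CTree D), comulAux (graft l cs c (forest F)) =
      toHc (graft l cs c (forest F)) ⊗ₜ[ℚ] 1 +
        ((cutsBelow cs).map fun e => (toHc (forest e.1) ⊗ₜ[ℚ] 1) *
          TensorProduct.map LinearMap.id (graftHc l e.2 c) (comulAux (forest F))).sum := by
    intro F
    have hg : graft l cs c (forest F) = MvPolynomial.X (.node l (cs ++ (Finsupp.toMultiset
        (F.map fun T => Finsupp.single T 1).sum).toList.map fun T => (c, T))) := by
      rw [forest_eq_basis, graft, Module.Basis.constr_basis]
    have hp : ((Finsupp.toMultiset (F.map fun T => Finsupp.single T 1).sum).toList.map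
        fun T => (c, T)).Perm (F.map fun T => (c, T)) := by
      apply List.Perm.map
      rw [← Multiset.coe_eq_coe]
      simp [toMultiset_forest]
    rw [hg, comulAux_node, cutSum_perm l (hp.append_left cs) (List.Perm.refl _), cutSum_append]
    simp only [List.nil_append, cutSum_forest]
  obtain ⟨p, rfl⟩ := exists_expr f
  induction p with
  | nil => simp [expr]
  | cons t p ih =>
    have e : (expr (t :: p) : Pre D) = t.1 • forest t.2 + expr p := by simp [expr]
    rw [e]
    simp only [map_add, map_smul, ih, hF, TensorProduct.add_tmul, mul_add, sum_map_add', smul_add,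
      TensorProduct.smul_tmul', mul_smul_comm]
    have h2 : (t.1 • ((cutsBelow cs).map fun e => (toHc (forest e.1) ⊗ₜ[ℚ] (1 : Hc D)) *
          TensorProduct.map LinearMap.id (graftHc l e.2 c) (comulAux (forest t.2))).sum) =
        ((cutsBelow cs).map fun e => t.1 • ((toHc (forest e.1) ⊗ₜ[ℚ] (1 : Hc D)) *
          TensorProduct.map LinearMap.id (graftHc l e.2 c) (comulAux (forest t.2)))).sum := by
      rw [List.smul_sum, List.map_map]
      rfl
    rw [h2]
    abel

theorem cutSum_label_linear (L : List (ℚ × List (ℚ × List (CTree D))))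
    (h : (L.map fun a => a.1 • expr a.2).sum ∈ relations D) (cs : List (Color × CTree D)) :
    (L.map fun a => a.1 • cutSum (.inr a.2) [] cs).sum = 0 := by
  simp only [cutSum, List.smul_sum, List.map_map]
  rw [sum_comm' L (cutsBelow cs)]
  refine List.sum_eq_zero ?_
  simp only [List.mem_map]
  rintro _ ⟨e, -, rfl⟩
  have h1 := toHc_eq_zero.2 (relations_compatible.label_linear L e.2 h)
  have h2 := congrArg (fun z => toHc (forest e.1) ⊗ₜ[ℚ] z) h1
  simp only [map_list_sum, List.map_map, TensorProduct.tmul_zero] at h2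
  rw [← h2]
  have h3 : ∀ (a : Hc D) (K : List (Hc D)), a ⊗ₜ[ℚ] K.sum = (K.map fun b => a ⊗ₜ[ℚ] b).sum := by
    intro a K
    induction K with
    | nil => simp
    | cons b K ih => simp [TensorProduct.tmul_add, ih]
  rw [h3, List.map_map]
  congr 1
  refine List.map_congr_left fun a _ => ?_
  simp

/-- The relations are respected by the coproduct. -/
theorem comulAux_relations {f : Pre D} (hf : f ∈ relations D) : comulAux f = 0 := by
  have hle : relations D ⊓ RingHom.ker (comulAux : Pre D →ₐ[ℚ] _) ≤ relations D := inf_le_left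
  suffices IsCompatible (relations D ⊓ RingHom.ker (comulAux : Pre D →ₐ[ℚ] _)) from
    (relations_le this hf).2
  refine ⟨fun l cs cs' h => ⟨relations_compatible.perm l cs cs' h, ?_⟩,
    fun l cs c f hf => ⟨relations_compatible.graft_mem l cs c f hf.1, ?_⟩,
    fun L cs h => ⟨relations_compatible.label_linear L cs h.1, ?_⟩,
    fun d cs => ⟨relations_compatible.label_basic d cs, ?_⟩,
    fun p h => ⟨relations_compatible.label_primitive p (primitive_of_le hle h), ?_⟩⟩
  · change comulAux _ = 0
    rw [map_sub, comulAux_node, comulAux_node, toHc_node_perm l h,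
      cutSum_perm l h (List.Perm.refl _), sub_self]
  · change comulAux _ = 0
    have h2 : comulAux f = 0 := hf.2
    have h1 := toHc_eq_zero.2 (relations_compatible.graft_mem l cs c f hf.1)
    rw [comulAux_graft, h1, h2]
    simp
  · change comulAux _ = 0
    have h1 := toHc_eq_zero.2 (relations_compatible.label_linear L cs h.1)
    have h2 := cutSum_label_linear L h.1 cs
    have h3 : comulAux ((L.map fun a =>
        a.1 • (MvPolynomial.X (.node (.inr a.2) cs) : Pre D)).sum) =
        toHc ((L.map fun a => a.1 • (MvPolynomial.X (.node (.inr a.2) cs) : Pre D)).sum) ⊗ₜ[ℚ] 1 +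
          (L.map fun a => a.1 • cutSum (.inr a.2) [] cs).sum := by
      clear h h1 h2
      induction L with
      | nil => simp
      | cons a L ih =>
        simp only [List.map_cons, List.sum_cons, map_add, ih, map_smul, comulAux_node, smul_add,
          TensorProduct.add_tmul, TensorProduct.smul_tmul']
        abel
    rw [h3, h1, h2]
    simp
  · change comulAux _ = 0
    have hb : ∀ cs, toHc (MvPolynomial.X (.node (.inr [(1, [.node (.inl d) []])]) cs) : Pre D) =
        toHc (MvPolynomial.X (.node (.inl d) cs)) := fun cs => sub_eq_zero.1 <| by
      rw [← map_sub]
      exact toHc_eq_zero.2 (relations_compatible.label_basic d cs)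
    rw [map_sub, comulAux_node, comulAux_node, hb, sub_eq_zero]
    simp only [cutSum, hb]
  · change comulAux _ = 0
    have h1 := primitive_of_le hle h
    have h2 : toHc (MvPolynomial.X (.node (.inr p) []) : Pre D) = toHc (expr p) :=
      sub_eq_zero.1 <| by
        rw [← map_sub]
        exact toHc_eq_zero.2 (relations_compatible.label_primitive p h1)
    have h3 : comulAux (expr p) = toHc (expr p) ⊗ₜ[ℚ] 1 + 1 ⊗ₜ[ℚ] toHc (expr p) := h1
    rw [map_sub, comulAux_node, h3, ← h2]
    simp [cutSum, cutsBelow, forest]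

/-- The coproduct of the algebra of coloured insertion trees. -/
noncomputable def comul : Hc D →ₐ[ℚ] Hc D ⊗[ℚ] Hc D :=
  Ideal.Quotient.liftₐ (relations D) comulAux fun _ hf => comulAux_relations hf

theorem comul_toHc (f : Pre D) :
    comul (toHc f) = Algebra.TensorProduct.map toHc toHc (preComul f) := rfl

/-- Primitive elements. -/
def IsPrimitive (γ : Hc D) : Prop := comul γ = γ ⊗ₜ[ℚ] 1 + 1 ⊗ₜ[ℚ] γ

theorem exists_label (γ : Hc D) : ∃ p : List (ℚ × List (CTree D)), toHc (expr p) = γ := by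
  obtain ⟨f, rfl⟩ := toHc_surjective γ
  obtain ⟨p, rfl⟩ := exists_expr f
  exact ⟨p, rfl⟩

/-- `R_+^γ`: add a root decorated by `γ`, joined to the roots of a forest by red edges. The choice of
a formal expression for `γ` does not matter, see `redPlus_forest`. -/
noncomputable def redPlus (γ : Hc D) : Hc D →ₗ[ℚ] Hc D :=
  graftHc (.inr (exists_label γ).choose) [] .red

theorem redPlus_forest (p : List (ℚ × List (CTree D))) (F : List (CTree D)) :
    redPlus (toHc (expr p)) (toHc (forest F)) =
      toHc (MvPolynomial.X (.node (.inr p) (F.map fun T => (Color.red, T)))) := by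
  have h := (exists_label (toHc (expr p))).choose_spec
  set p' := (exists_label (toHc (expr p))).choose with hp'
  rw [redPlus, ← hp', graftHc_toHc, graft_forest, List.nil_append, ← sub_eq_zero, ← map_sub,
    toHc_eq_zero]
  have := relations_compatible.label_linear [(1, p'), (-1, p)]
    (F.map fun T => (Color.red, T)) (by
      simp only [List.map_cons, List.map_nil, List.sum_cons, List.sum_nil, one_smul, neg_smul,
        add_zero]
      rw [← sub_eq_add_neg, ← toHc_eq_zero, map_sub, h, sub_self])
  simpa [sub_eq_add_neg] using this

/-- Trees with basic decorations at all vertices and only black edges. -/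
inductive IsBlack : CTree D → Prop
  | node (d : D) (cs : List (Color × CTree D))
      (hc : ∀ e ∈ cs, e.1 = Color.black) (ht : ∀ e ∈ cs, IsBlack e.2) : IsBlack (.node (.inl d) cs)

/-- The subalgebra of (uncoloured, that is entirely black) insertion trees. -/
noncomputable def blackTrees (D : Type u) : Subalgebra ℚ (Hc D) :=
  Algebra.adjoin ℚ {a | ∃ T : CTree D, IsBlack T ∧ a = toHc (MvPolynomial.X T)}

/-- `H` is closed under the coproduct: `Δ(H) ⊆ H ⊗ H`. -/
def IsSubcoalgebra (H : Subalgebra ℚ (Hc D)) : Prop :=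
  ∀ h ∈ H, comul h ∈ (Algebra.TensorProduct.map H.val H.val).range

/-- `L` is a Hochschild 1-cocycle on `H`: `Δ L = (id ⊗ L) Δ + L ⊗ 𝕀`. -/
def IsCocycleOn (H : Subalgebra ℚ (Hc D)) (L : Hc D →ₗ[ℚ] Hc D) : Prop :=
  ∀ h ∈ H, comul (L h) = TensorProduct.map LinearMap.id L (comul h) + L h ⊗ₜ[ℚ] 1

/-- The sign of an integer, with the convention `sign 0 = 1`. -/
def dseSign (s : ℤ) : ℚ := if s < 0 then -1 else 1

/-- Integer powers of a power series with constant term `1`. -/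
noncomputable def intPow (f : PowerSeries (Hc D)) : ℤ → PowerSeries (Hc D)
  | .ofNat n => f ^ n
  | .negSucc n => PowerSeries.invOfUnit f 1 ^ (n + 1)

section System

variable {ι : Type v} [Fintype ι]

/-- The invariant charge `Q = ∏ r, (X^r)^(-s_r)`. -/
noncomputable def invariantCharge (s : ι → ℤ) (X : ι → PowerSeries (Hc D)) : PowerSeries (Hc D) :=
  ∏ r, intPow (X r) (-s r)

/-- The series `∑_{k ≥ 1} x^k L_k(Y_k)`, where `L_k` acts on each coefficient of `Y_k`. -/
noncomputable def insertionSeries (L : ℕ → Hc D →ₗ[ℚ] Hc D) (Y : ℕ → PowerSeries (Hc D)) :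
    PowerSeries (Hc D) :=
  PowerSeries.mk fun n => ∑ k ∈ Finset.Icc 1 n, L k (PowerSeries.coeff (n - k) (Y k))

/-- The system `X^r = 𝕀 - sign(s_r) ∑_{k ≥ 1} x^k L^r_k(X^r Q^k)` of Dyson–Schwinger equations. -/
def DysonSchwinger (s : ι → ℤ) (L : ι → ℕ → Hc D →ₗ[ℚ] Hc D) (X : ι → PowerSeries (Hc D)) :
    Prop :=
  ∀ r, X r = 1 - dseSign (s r) •
    insertionSeries (L r) fun k => X r * invariantCharge s X ^ k

/-- The elements
`q^r_n = -sign(s_r) [x^n] X^r - ∑_{k=1}^{n-1} R_+^{q^r_k}([x^{n-k}] X^r Q^k)`, for `n ≥ 1`. -/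
noncomputable def q (s : ι → ℤ) (X : ι → PowerSeries (Hc D)) (r : ι) (n : ℕ) : Hc D :=
  -(dseSign (s r) • PowerSeries.coeff n (X r)) -
    ∑ k ∈ (Finset.Ico 1 n).attach,
      redPlus (q s X r k.1) (PowerSeries.coeff (n - k.1) (X r * invariantCharge s X ^ k.1))
termination_by n
decreasing_by exact (Finset.mem_Ico.1 k.2).2

end System

end InsertionTree

open InsertionTree

-- Everything rests on one coproduct formula, Δ([x^n] X^r Q^k) = ∑_j [x^(n-j)] X^r Q^(k+j) ⊗ [x^j]
-- X^r Q^k.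
--
-- Let χ(f) = ∑_j x^j Q^j ⊗ [x^j] f, the substitution x ↦ xQ with Q in the left factor. The case k =
-- 0 says Δ(X^r) = (X^r ⊗ 1) χ(X^r). Since Δ, f ↦ f ⊗ 1 and χ are ring homomorphisms, this relation
-- passes to integer powers and products, hence to X^r Q^k (`map_mul_charge_pow`,
-- `ComulFormula.of_lt`). The case k = 0 itself follows by induction on n: the equation expresses
-- [x^n] X^r through lower coefficients of the X^r Q^k, and the cocycle identity for the insertion
-- operators turns the formula for these into the one for X^r (`sum_map_comul`,
-- `DysonSchwinger.comulFormula`).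
--
-- The maps R_+^γ are cocycles for every γ, so the same computation applies to them. For U_n =
-- -sign(s_r) [x^n] X^r - ∑_{k=1}^{n} R_+^{q_k}([x^(n-k)] X^r Q^k) it gives Δ U_n = U_n ⊗ 𝕀 +
-- ∑_{m=1}^{n} [x^(n-m)] X^r Q^m ⊗ U_m. If q_m is primitive, then R_+^{q_m}(𝕀) = q_m, which means
-- U_m = 0. By induction only m = n survives, so U_n is primitive, and so is q_n = U_n +
-- R_+^{q_n}(𝕀). The resulting equations U_n = 0 are the red Dyson–Schwinger equations.

namespace InsertionTree

-- Red grafting as a Hochschild cocycle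

section RedPlus

variable {D : Type u}

/-- Grafting to a root is a Hochschild 1-cocycle on the algebra of coloured trees. -/
theorem comul_redPlus (γ h : Hc D) :
    comul (redPlus γ h) =
      redPlus γ h ⊗ₜ[ℚ] 1 + TensorProduct.map LinearMap.id (redPlus γ) (comul h) := by
  obtain ⟨f, rfl⟩ := toHc_surjective h
  have := comulAux_graft (.inr (exists_label γ).choose) [] .red f
  -- Before grafting the root has no children, so the empty cut is the only one and the sum has a
  -- single term.
  simp only [cutsBelow, List.map_cons, List.map_nil, List.sum_cons, List.sum_nil, add_zero,
    forest, List.prod_nil, map_one] at this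
  rw [← Algebra.TensorProduct.one_def, one_mul] at this
  exact this

theorem redPlus_one {γ : Hc D} (hγ : IsPrimitive γ) : redPlus γ 1 = γ := by
  obtain ⟨p, rfl⟩ := exists_label γ
  have h1 := redPlus_forest p []
  simp only [forest, List.map_nil, List.prod_nil, map_one] at h1
  rw [h1, ← sub_eq_zero, ← map_sub, toHc_eq_zero]
  -- Primitivity in `Hc D` unfolds to the hypothesis of `label_primitive` for the ideal `relations
  -- D`.
  exact relations_compatible.label_primitive p hγ

end RedPlus

-- Power series: truncation and the substitution x ↦ xQ

section PowerSeries

variable {A : Type u} [CommRing A]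

theorem mul_invOfUnit_one {f : PowerSeries A} (hf : PowerSeries.constantCoeff f = 1) :
    f * PowerSeries.invOfUnit f 1 = 1 :=
  PowerSeries.mul_invOfUnit f 1 (by simpa using hf)

/-- A power series with constant term `1` as a unit. -/
noncomputable def seriesUnit (f : PowerSeries A) (hf : PowerSeries.constantCoeff f = 1) :
    (PowerSeries A)ˣ where
  val := f
  inv := PowerSeries.invOfUnit f 1
  val_inv := mul_invOfUnit_one hf
  inv_val := by rw [mul_comm, mul_invOfUnit_one hf]

/-- The power series whose first `n` coefficients lie in a given subring. -/
def coeffSubring (S : Subring A) (n : ℕ) : Subring (PowerSeries A) where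
  carrier := {f | ∀ j < n, PowerSeries.coeff j f ∈ S}
  zero_mem' j _ := by simp
  one_mem' j _ := by
    rw [PowerSeries.coeff_one]
    split_ifs
    exacts [S.one_mem, S.zero_mem]
  add_mem' hf hg j hj := by
    rw [map_add]
    exact S.add_mem (hf j hj) (hg j hj)
  neg_mem' hf j hj := by
    rw [map_neg]
    exact S.neg_mem (hf j hj)
  mul_mem' {f g} hf hg j hj := by
    rw [PowerSeries.coeff_mul]
    refine S.sum_mem fun p hp => ?_
    have := Finset.HasAntidiagonal.mem_antidiagonal.1 hp
    exact S.mul_mem (hf _ (by omega)) (hg _ (by omega))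

/-- The recursion for the coefficients of the inverse divides only by the prescribed unit 1, so it
never leaves `S`. -/
theorem invOfUnit_mem_coeffSubring {S : Subring A} {n : ℕ} {f : PowerSeries A}
    (hf : f ∈ coeffSubring S n) : PowerSeries.invOfUnit f 1 ∈ coeffSubring S n := by
  intro j
  induction j using Nat.strong_induction_on with
  | _ j ih =>
    intro hj
    rw [PowerSeries.coeff_invOfUnit]
    split_ifs with h0
    · simp
    · simp only [inv_one, Units.val_one, neg_mul, one_mul]
      refine S.neg_mem (S.sum_mem fun p hp => ?_)
      have := Finset.HasAntidiagonal.mem_antidiagonal.1 hp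
      split_ifs with h
      · exact S.mul_mem (hf _ (by omega)) (ih _ h (by omega))
      · exact S.zero_mem

variable [Algebra ℚ A]

/-- The ring homomorphism `f ↦ ∑ j, x ^ j Q ^ j ⊗ [x ^ j] f`. -/
noncomputable def chargeSubst (Q : PowerSeries A) : PowerSeries A →+* PowerSeries (A ⊗[ℚ] A) :=
  (PowerSeries.substAlgHom (R := A ⊗[ℚ] A)
    (a := PowerSeries.X * PowerSeries.map
      (Algebra.TensorProduct.includeLeftRingHom : A →+* A ⊗[ℚ] A) Q)
    (PowerSeries.HasSubst.of_constantCoeff_zero' (by simp))).toRingHom.comp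
    (PowerSeries.map (Algebra.TensorProduct.includeRight : A →ₐ[ℚ] A ⊗[ℚ] A).toRingHom)

/-- The series x^j Q^j starts in degree j, so terms with j > N do not matter. A cutoff independent
of `m` lets one finite sum serve all coefficients that enter a product. -/
theorem coeff_chargeSubst (Q f : PowerSeries A) {m N : ℕ} (hm : m ≤ N) :
    PowerSeries.coeff m (chargeSubst Q f) =
      PowerSeries.coeff m (∑ j ∈ Finset.range (N + 1),
        PowerSeries.C ((1 : A) ⊗ₜ[ℚ] PowerSeries.coeff j f) * (PowerSeries.X ^ j *
          PowerSeries.map (Algebra.TensorProduct.includeLeftRingHom : A →+* A ⊗[ℚ] A) (Q ^ j))) := by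
  have hs : PowerSeries.HasSubst (PowerSeries.X * PowerSeries.map
      (Algebra.TensorProduct.includeLeftRingHom : A →+* A ⊗[ℚ] A) Q) :=
    PowerSeries.HasSubst.of_constantCoeff_zero' (by simp)
  change PowerSeries.coeff m (PowerSeries.substAlgHom (R := A ⊗[ℚ] A) hs _) = _
  rw [PowerSeries.coe_substAlgHom, PowerSeries.coeff_subst' hs,
    finsum_eq_sum_of_support_subset (s := Finset.range (N + 1))]
  · rw [map_sum]
    refine Finset.sum_congr rfl fun j _ => ?_
    rw [PowerSeries.coeff_C_mul, mul_pow, map_pow, smul_eq_mul, PowerSeries.coeff_map]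
    rfl
  · intro j hj
    by_contra h
    refine hj ?_
    have h : N < j := by simpa using h
    change _ • _ = _
    rw [mul_pow, PowerSeries.coeff_X_pow_mul', if_neg (by omega), smul_zero]

/-- For `Y` and `f` both equal to X^r Q^k, the right-hand side is that of the coproduct formula. -/
theorem coeff_mul_chargeSubst (Q f Y : PowerSeries A) (n : ℕ) :
    PowerSeries.coeff n (PowerSeries.map
      (Algebra.TensorProduct.includeLeftRingHom : A →+* A ⊗[ℚ] A) Y * chargeSubst Q f) =
      ∑ j ∈ Finset.range (n + 1),
        PowerSeries.coeff (n - j) (Y * Q ^ j) ⊗ₜ[ℚ] PowerSeries.coeff j f := by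
  rw [PowerSeries.coeff_mul, Finset.sum_congr rfl fun p hp => by
    rw [coeff_chargeSubst Q f (N := n)
      (by have := Finset.HasAntidiagonal.mem_antidiagonal.1 hp; omega)],
    ← PowerSeries.coeff_mul, Finset.mul_sum, map_sum]
  refine Finset.sum_congr rfl fun j hj => ?_
  have hj : j ≤ n := by have := Finset.mem_range.1 hj; omega
  rw [mul_left_comm, PowerSeries.coeff_C_mul, mul_left_comm, ← map_mul,
    PowerSeries.coeff_X_pow_mul', if_pos hj, PowerSeries.coeff_map]
  simp

end PowerSeries

-- Powers of the series and of the invariant charge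

section System

variable {D : Type u} {ι : Type v} [Fintype ι]

/-- Gives `intPow` access to the laws of integer powers in a group of units, negative exponents
included. -/
theorem coe_seriesUnit_zpow (f : PowerSeries (Hc D)) (hf : PowerSeries.constantCoeff f = 1) (z : ℤ) :
    ((seriesUnit f hf ^ z : (PowerSeries (Hc D))ˣ) : PowerSeries (Hc D)) = intPow f z := by
  cases z with
  | ofNat n => simp [intPow, seriesUnit]
  | negSucc n =>
    rw [zpow_negSucc, ← inv_pow, Units.val_pow_eq_pow_val]
    rfl

theorem intPow_mem_coeffSubring {S : Subring (Hc D)} {n : ℕ} {f : PowerSeries (Hc D)}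
    (hf : f ∈ coeffSubring S n) (z : ℤ) : intPow f z ∈ coeffSubring S n := by
  cases z with
  | ofNat m => exact pow_mem hf m
  | negSucc m => exact pow_mem (invOfUnit_mem_coeffSubring hf) (m + 1)

/-- Used with `S` = `H`: the arguments of the insertion operators stay in `H`, where the cocycle
identity is available. -/
theorem mul_charge_pow_mem_coeffSubring {S : Subring (Hc D)} {n : ℕ}
    {X : ι → PowerSeries (Hc D)} (s : ι → ℤ) (hX : ∀ r, X r ∈ coeffSubring S n) (r : ι) (k : ℕ) :
    X r * invariantCharge s X ^ k ∈ coeffSubring S n :=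
  mul_mem (hX r) (pow_mem (prod_mem fun i _ => intPow_mem_coeffSubring (hX i) _) k)

theorem constantCoeff_intPow {f : PowerSeries (Hc D)} (hf : PowerSeries.constantCoeff f = 1)
    (z : ℤ) : PowerSeries.constantCoeff (intPow f z) = 1 := by
  cases z with
  | ofNat m => simp [intPow, hf]
  | negSucc m => simp [intPow]

theorem constantCoeff_mul_charge_pow {X : ι → PowerSeries (Hc D)} (s : ι → ℤ)
    (hX : ∀ r, PowerSeries.constantCoeff (X r) = 1) (r : ι) (k : ℕ) :
    PowerSeries.constantCoeff (X r * invariantCharge s X ^ k) = 1 := by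
  simp [invariantCharge, hX, constantCoeff_intPow]

/-- A relation `φ(X^r) = α(X^r) β(X^r)` between ring homomorphisms extends to `X^r Q^k`. -/
theorem map_mul_charge_pow {C : Type*} [CommRing C] {X : ι → PowerSeries (Hc D)} (s : ι → ℤ)
    (hX : ∀ r, PowerSeries.constantCoeff (X r) = 1) (φ α β : PowerSeries (Hc D) →+* C)
    (h : ∀ r, φ (X r) = α (X r) * β (X r)) (r : ι) (k : ℕ) :
    φ (X r * invariantCharge s X ^ k) =
      α (X r * invariantCharge s X ^ k) * β (X r * invariantCharge s X ^ k) := by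
  have hu : ∀ i, Units.map (φ : PowerSeries (Hc D) →* C) (seriesUnit (X i) (hX i)) =
      Units.map (α : PowerSeries (Hc D) →* C) (seriesUnit (X i) (hX i)) *
        Units.map (β : PowerSeries (Hc D) →* C) (seriesUnit (X i) (hX i)) := fun i =>
    Units.ext (h i)
  have hz : ∀ i (z : ℤ), φ (intPow (X i) z) = α (intPow (X i) z) * β (intPow (X i) z) := by
    intro i z
    have := congrArg (fun u : Cˣ => ((u ^ z : Cˣ) : C)) (hu i)
    simp only [mul_zpow, ← map_zpow, Units.val_mul, Units.coe_map] at this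
    rw [coe_seriesUnit_zpow] at this
    exact this
  simp only [invariantCharge, map_mul, map_pow, map_prod, h, hz, Finset.prod_mul_distrib, mul_pow]
  ring

-- Coefficients of a solution

variable {s : ι → ℤ} {L : ι → ℕ → Hc D →ₗ[ℚ] Hc D} {X : ι → PowerSeries (Hc D)}

theorem dseSign_mul_self (z : ℤ) : dseSign z * dseSign z = 1 := by
  unfold dseSign
  split_ifs <;> norm_num

theorem DysonSchwinger.constantCoeff (hX : DysonSchwinger s L X) (r : ι) :
    PowerSeries.constantCoeff (X r) = 1 := by
  rw [hX r, ← PowerSeries.coeff_zero_eq_constantCoeff_apply, map_sub, PowerSeries.coeff_smul]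
  simp [insertionSeries]

theorem DysonSchwinger.coeff (hX : DysonSchwinger s L X) (r : ι) {n : ℕ} (hn : 1 ≤ n) :
    PowerSeries.coeff n (X r) = -(dseSign (s r) • ∑ k ∈ Finset.Icc 1 n,
      L r k (PowerSeries.coeff (n - k) (X r * invariantCharge s X ^ k))) := by
  conv_lhs => rw [hX r]
  rw [map_sub, PowerSeries.coeff_smul, PowerSeries.coeff_one, if_neg (by omega), zero_sub,
    insertionSeries, PowerSeries.coeff_mk]

/-- The solution of a Dyson–Schwinger system has coefficients in every subalgebra preserved by the
insertion operators. -/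
theorem DysonSchwinger.coeff_mem (hX : DysonSchwinger s L X) (H : Subalgebra ℚ (Hc D))
    (hL : ∀ r, ∀ k ≥ 1, ∀ h ∈ H, L r k h ∈ H) (n : ℕ) :
    ∀ r, X r ∈ coeffSubring H.toSubring n := by
  induction n with
  | zero => exact fun r j hj => absurd hj (by omega)
  | succ n ih =>
    intro r j hj
    rcases Nat.eq_zero_or_pos j with rfl | h0
    · rw [PowerSeries.coeff_zero_eq_constantCoeff_apply, hX.constantCoeff]
      exact H.one_mem
    · rw [hX.coeff r h0]
      refine H.neg_mem (H.smul_mem (H.sum_mem fun k hk => ?_) _)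
      have hk := Finset.mem_Icc.1 hk
      -- Since k ≥ 1 and j ≤ n, the degree j - k is below n.
      exact hL r k hk.1 _ (mul_charge_pow_mem_coeffSubring s ih r k _ (by omega))

-- The coproduct formula

/-- The coproduct formula for `[x^n] X^r Q^k`. -/
def ComulFormula (s : ι → ℤ) (X : ι → PowerSeries (Hc D)) (r : ι) (k n : ℕ) : Prop :=
  comul (PowerSeries.coeff n (X r * invariantCharge s X ^ k)) =
    ∑ j ∈ Finset.range (n + 1),
      PowerSeries.coeff (n - j) (X r * invariantCharge s X ^ (k + j)) ⊗ₜ[ℚ]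
        PowerSeries.coeff j (X r * invariantCharge s X ^ k)

/-- If the coproduct formula holds for `X^r` in degrees less than `N`, then so it does for
`X^r Q^k`. -/
theorem ComulFormula.of_lt (hX : ∀ r, PowerSeries.constantCoeff (X r) = 1) {N : ℕ}
    (h : ∀ r, ∀ n < N, ComulFormula s X r 0 n) (r : ι) (k : ℕ) {n : ℕ} (hn : n < N) :
    ComulFormula s X r k n := by
  set Q := invariantCharge s X with hQ
  -- Modulo x^N the hypothesis in degrees below N becomes an honest identity between values of ring
  -- homomorphisms, so multiplicativity applies.
  let π := Ideal.Quotient.mk (Ideal.span {(PowerSeries.X : PowerSeries (Hc D ⊗[ℚ] Hc D)) ^ N})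
  have hπ : ∀ f g, π f = π g ↔ ∀ m < N, PowerSeries.coeff m f = PowerSeries.coeff m g := by
    intro f g
    rw [Ideal.Quotient.eq, Ideal.mem_span_singleton, PowerSeries.X_pow_dvd_iff]
    simp [sub_eq_zero]
  have key := map_mul_charge_pow s hX
    (π.comp (PowerSeries.map (comul : Hc D →ₐ[ℚ] _).toRingHom))
    (π.comp (PowerSeries.map Algebra.TensorProduct.includeLeftRingHom))
    (π.comp (chargeSubst Q)) (fun i => by
      simp only [RingHom.comp_apply, ← map_mul π]
      rw [hπ]
      intro m hm
      rw [coeff_mul_chargeSubst, PowerSeries.coeff_map]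
      simpa [ComulFormula] using h i m hm) r k
  simp only [RingHom.comp_apply, ← map_mul π] at key
  have := (hπ _ _).1 key n hn
  rw [coeff_mul_chargeSubst, PowerSeries.coeff_map] at this
  simp only [mul_assoc, ← hQ, ← pow_add] at this
  exact this

theorem comulFormula_zero_iff (hX : ∀ r, PowerSeries.constantCoeff (X r) = 1) (r : ι) (n : ℕ) :
    ComulFormula s X r 0 n ↔
      comul (PowerSeries.coeff n (X r)) = PowerSeries.coeff n (X r) ⊗ₜ[ℚ] 1 +
        ∑ m ∈ Finset.Icc 1 n, PowerSeries.coeff (n - m) (X r * invariantCharge s X ^ m) ⊗ₜ[ℚ]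
          PowerSeries.coeff m (X r) := by
  have e : Finset.range (n + 1) = insert 0 (Finset.Icc 1 n) := by
    ext m
    simp only [Finset.mem_range, Finset.mem_insert, Finset.mem_Icc]
    omega
  rw [ComulFormula, e, Finset.sum_insert (by simp)]
  simp [hX]

/-- Put m = k + j: the left factor [x^(n-k-j)] X^r Q^(k+j) depends on m alone, so the right factors
can be collected. The maps `L` are arbitrary; the lemma serves both the given insertions and the red
ones. As k ≥ 1, only degrees below n are needed. -/
theorem sum_map_comul {r : ι} {n : ℕ} (h : ∀ k, ∀ m < n, ComulFormula s X r k m)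
    (L : ℕ → Hc D →ₗ[ℚ] Hc D) :
    ∑ k ∈ Finset.Icc 1 n, TensorProduct.map LinearMap.id (L k)
        (comul (PowerSeries.coeff (n - k) (X r * invariantCharge s X ^ k))) =
      ∑ m ∈ Finset.Icc 1 n, PowerSeries.coeff (n - m) (X r * invariantCharge s X ^ m) ⊗ₜ[ℚ]
        ∑ k ∈ Finset.Icc 1 m, L k (PowerSeries.coeff (m - k) (X r * invariantCharge s X ^ k)) := by
  simp only [TensorProduct.tmul_sum]
  rw [Finset.sum_comm' (t' := Finset.Icc 1 n) (s' := fun k => Finset.Icc k n) (by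
    intro m k
    simp only [Finset.mem_Icc]
    omega)]
  refine Finset.sum_congr rfl fun k hk => ?_
  have hk := Finset.mem_Icc.1 hk
  rw [h k (n - k) (by omega), map_sum]
  refine Finset.sum_bij' (fun j _ => k + j) (fun m _ => m - k) ?_ ?_ ?_ ?_ ?_
  · intro j hj
    simp only [Finset.mem_Icc, Finset.mem_range] at *
    omega
  · intro j hj
    simp only [Finset.mem_Icc, Finset.mem_range] at *
    omega
  · intro j hj
    omega
  · intro m hm
    simp only [Finset.mem_Icc] at *
    omega
  · intro j hj
    rw [TensorProduct.map_tmul, LinearMap.id_apply, Nat.add_sub_cancel_left, Nat.sub_sub]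

/-- The coproduct of the solution of a Dyson–Schwinger system with 1-cocycles as insertion
operators. -/
theorem DysonSchwinger.comulFormula (hX : DysonSchwinger s L X) (H : Subalgebra ℚ (Hc D))
    (hL : ∀ r, ∀ k ≥ 1, ∀ h ∈ H, L r k h ∈ H) (hcoc : ∀ r, ∀ k ≥ 1, IsCocycleOn H (L r k))
    (r : ι) (n : ℕ) : ComulFormula s X r 0 n := by
  induction n using Nat.strong_induction_on generalizing r with
  | _ n ih =>
    have hc := hX.constantCoeff
    rcases Nat.eq_zero_or_pos n with rfl | hn
    · have := hc r
      rw [← PowerSeries.coeff_zero_eq_constantCoeff_apply] at this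
      simp [ComulFormula, hc, Algebra.TensorProduct.one_def]
    have hmem : ∀ k ∈ Finset.Icc 1 n,
        PowerSeries.coeff (n - k) (X r * invariantCharge s X ^ k) ∈ H := fun k hk =>
      mul_charge_pow_mem_coeffSubring s (hX.coeff_mem H hL (n + 1)) r k _ (by omega)
    -- This is the (id ⊗ L)Δ part of the cocycle identity; the L ⊗ 𝕀 parts add up to [x^n] X^r ⊗ 𝕀,
    -- up to the common sign.
    have hsum := sum_map_comul (s := s) (fun k m hm =>
      ComulFormula.of_lt hc (fun r m hm => ih m hm r) r k hm) (L r)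
    have h1 : comul (PowerSeries.coeff n (X r)) = PowerSeries.coeff n (X r) ⊗ₜ[ℚ] 1 +
        ∑ m ∈ Finset.Icc 1 n, PowerSeries.coeff (n - m) (X r * invariantCharge s X ^ m) ⊗ₜ[ℚ]
          PowerSeries.coeff m (X r) := by
      rw [Finset.sum_congr rfl fun m hm => by rw [hX.coeff r (Finset.mem_Icc.1 hm).1],
        hX.coeff r hn]
      simp only [TensorProduct.tmul_neg, TensorProduct.tmul_smul, Finset.sum_neg_distrib,
        ← Finset.smul_sum, ← hsum]
      rw [map_neg, map_smul, map_sum, Finset.sum_congr rfl fun k hk =>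
        hcoc r k (Finset.mem_Icc.1 hk).1 _ (hmem k hk), Finset.sum_add_distrib,
        TensorProduct.neg_tmul, ← TensorProduct.smul_tmul', TensorProduct.sum_tmul, smul_add]
      abel
    exact (comulFormula_zero_iff hc r n).2 h1

-- Primitivity of the q^r_n and the red equations

/-- The term k = n, absent from the recursion, is subtracted and added back; it is R_+^{q_n}(𝕀)
because X^r Q^n has constant term 𝕀. It cannot yet be replaced by q_n, whose primitivity is still
open. -/
theorem q_eq (s : ι → ℤ) (X : ι → PowerSeries (Hc D))
    (hX : ∀ r, PowerSeries.constantCoeff (X r) = 1) (r : ι) {n : ℕ} (hn : 1 ≤ n) :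
    q s X r n = (-(dseSign (s r) • PowerSeries.coeff n (X r)) - ∑ k ∈ Finset.Icc 1 n,
      redPlus (q s X r k) (PowerSeries.coeff (n - k) (X r * invariantCharge s X ^ k))) +
        redPlus (q s X r n) 1 := by
  conv_lhs => rw [q]
  rw [Finset.sum_attach (Finset.Ico 1 n) fun k =>
    redPlus (q s X r k) (PowerSeries.coeff (n - k) (X r * invariantCharge s X ^ k)),
    ← Finset.Ico_add_one_right_eq_Icc, Finset.sum_Ico_succ_top hn, Nat.sub_self,
    PowerSeries.coeff_zero_eq_constantCoeff_apply, constantCoeff_mul_charge_pow s hX]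
  abel

/-- In every degree in which `q^r_n` is primitive, the series satisfy the system with red
insertions. -/
theorem red_equation (hX : ∀ r, PowerSeries.constantCoeff (X r) = 1) (r : ι) {n : ℕ} (hn : 1 ≤ n)
    (hq : IsPrimitive (q s X r n)) :
    -(dseSign (s r) • PowerSeries.coeff n (X r)) = ∑ k ∈ Finset.Icc 1 n,
      redPlus (q s X r k) (PowerSeries.coeff (n - k) (X r * invariantCharge s X ^ k)) := by
  have := q_eq s X hX r hn
  rw [redPlus_one hq] at this
  exact sub_eq_zero.1 (left_eq_add.1 (this.trans (add_comm _ _)))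

theorem IsPrimitive.add {a b : Hc D} (ha : IsPrimitive a) (hb : IsPrimitive b) :
    IsPrimitive (a + b) := by
  unfold IsPrimitive at *
  rw [map_add, ha, hb, TensorProduct.add_tmul, TensorProduct.tmul_add]
  abel

/-- No primitivity of γ is required. This avoids a circle in `isPrimitive_q`, where γ is the element
q_n under examination. -/
theorem isPrimitive_redPlus_one (γ : Hc D) : IsPrimitive (redPlus γ 1) := by
  rw [IsPrimitive, comul_redPlus, map_one comul, Algebra.TensorProduct.one_def,
    TensorProduct.map_tmul, LinearMap.id_apply]

/-- The coproduct formula makes all `q^r_n` primitive. -/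
theorem isPrimitive_q (hX : ∀ r, PowerSeries.constantCoeff (X r) = 1)
    (h : ∀ r n, ComulFormula s X r 0 n) (r : ι) (n : ℕ) (hn : 1 ≤ n) :
    IsPrimitive (q s X r n) := by
  induction n using Nat.strong_induction_on with
  | _ n ih =>
    rw [q_eq s X hX r hn]
    refine IsPrimitive.add ?_ (isPrimitive_redPlus_one _)
    have hsum := sum_map_comul (s := s) (n := n) (fun k m hm =>
      ComulFormula.of_lt hX (N := n) (fun r m _ => h r m) r k hm) (fun k => redPlus (q s X r k))
    -- The right tensor factor is U_m, which vanishes for m < n by the induction hypothesis.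
    have hU : ∀ m ∈ Finset.Icc 1 n, m ≠ n →
        PowerSeries.coeff (n - m) (X r * invariantCharge s X ^ m) ⊗ₜ[ℚ]
          (-(dseSign (s r) • PowerSeries.coeff m (X r)) - ∑ k ∈ Finset.Icc 1 m,
            redPlus (q s X r k) (PowerSeries.coeff (m - k) (X r * invariantCharge s X ^ k))) =
          0 := by
      intro m hm hne
      have hm := Finset.mem_Icc.1 hm
      rw [red_equation hX r hm.1 (ih m (by omega) hm.1), sub_self, TensorProduct.tmul_zero]
    have hU := Finset.sum_eq_single_of_mem n (Finset.mem_Icc.2 ⟨hn, le_rfl⟩) hU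
    rw [Nat.sub_self, PowerSeries.coeff_zero_eq_constantCoeff_apply,
      constantCoeff_mul_charge_pow s hX] at hU
    -- Here 𝕀 ⊗ U_n is expanded back into the full sum over m, which then matches Δ U_n term by
    -- term.
    rw [IsPrimitive, ← hU, map_sub, map_neg, map_smul, (comulFormula_zero_iff hX r n).1 (h r n),
      map_sum]
    simp only [comul_redPlus, Finset.sum_add_distrib, hsum, TensorProduct.tmul_sub,
      TensorProduct.tmul_neg, TensorProduct.tmul_smul, TensorProduct.sub_tmul,
      TensorProduct.neg_tmul, TensorProduct.sum_tmul, Finset.sum_sub_distrib,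
      Finset.sum_neg_distrib, ← Finset.smul_sum, smul_add, ← TensorProduct.smul_tmul']
    abel

end System

end InsertionTree

-- The theorem

theorem mainTheorem6 {D : Type*} {ι : Type*} [Fintype ι]
    (H : Subalgebra ℚ (Hc D)) (hblack : H ≤ blackTrees D) (hH : IsSubcoalgebra H)
    (s : ι → ℤ) (t : ι → ℕ → ℕ) (B : ι → ℕ → ℕ → Hc D →ₗ[ℚ] Hc D)
    (hB : ∀ r, ∀ k ≥ 1, ∀ i ≤ t r k, ∀ h ∈ H, B r k i h ∈ H)
    (hcocycle : ∀ r, ∀ k ≥ 1, IsCocycleOn H (∑ i ∈ Finset.range (t r k + 1), B r k i))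
    (X : ι → PowerSeries (Hc D))
    (hX : DysonSchwinger s (fun r k => ∑ i ∈ Finset.range (t r k + 1), B r k i) X) :
    (∀ r, ∀ n ≥ 1, IsPrimitive (q s X r n)) ∧
      DysonSchwinger s (fun r k => redPlus (q s X r k)) X := by
  have hL : ∀ r, ∀ k ≥ 1, ∀ h ∈ H, (∑ i ∈ Finset.range (t r k + 1), B r k i) h ∈ H := by
    intro r k hk h hh
    rw [LinearMap.sum_apply]
    exact H.sum_mem fun i hi => hB r k hk i (by have := Finset.mem_range.1 hi; omega) h hh
  have hc := hX.constantCoeff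
  have hprim := isPrimitive_q hc (hX.comulFormula H hL hcocycle)
  refine ⟨hprim, fun r => PowerSeries.ext fun n => ?_⟩
  rw [map_sub, PowerSeries.coeff_smul, insertionSeries, PowerSeries.coeff_mk]
  rcases Nat.eq_zero_or_pos n with rfl | hn
  · simp [hc]
  -- The sign squares to 1, so the relation U_n = 0 can be solved for [x^n] X^r.
  · rw [← red_equation hc r hn (hprim r n hn), PowerSeries.coeff_one, if_neg (by omega), smul_neg,
      smul_smul, dseSign_mul_self, one_smul, zero_sub, neg_neg]
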